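/- Let $\mathfrak S_n$ be the set of permutations of $[n]=\{1,\dots,n\}$, written as words $\pi=\pi_1\cdots\pi_n$. For a pattern $p\in\mathfrak S_k$, say that $\pi$ avoids $p$ if there are no $i_1<\cdots<i_k$ such that $\pi_{i_1}\cdots\pi_{i_k}$ is order isomorphic to $p$, and let $\mathfrak S_n(p)$ be the set of $\pi\in\mathfrak S_n$ that avoid $p$. The stack-sorting operation $\mathcal S$ on words with distinct letters is defined recursively by $\mathcal S(\emptyset)=\emptyset$ and $\mathcal S(u\,m\,v)=\mathcal S(u)\,\mathcal S(v)\,m$, where $m$ is the largest letter. A permutation $\pi\in\mathfrak S_n$ is $t$-stack-sortable if $\mathcal S^t(\pi)=12\cdots n$; let $\mathfrak S_n^t(p)$ be the set of $t$-stack-sortable permutations in $\mathfrak S_n(p)$. For $\pi\in\mathfrak S_n$, let $\mathsf{fix}(\pi)$ be the number of $i$ with $\pi_i=i$; let $\mathsf{drop}(\pi)$ be the number of $i$ with $\pi_i<i$; let $\mathsf{des}(\pi)$ be the number of $i<n$ with $\pi_i>\pi_{i+1}$; and let $\mathsf{bad}(\pi)$ be the number of $i$ such that $\pi_i<\pi_j$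 for all $j>i$ and, moreover, $i=1$ or $\pi_{i-1}<\pi_i$. **Theorem.** For every $n\ge 0$ there is a bijection $\Upsilon:\mathfrak S_n(321)\to\mathfrak S_n(213)$ such that, for every $\pi\in\mathfrak S_n(321)$, - for every $t\ge1$, $\Upsilon(\pi)$ is $t$-stack-sortable if and only if $\pi$ is $t$-stack-sortable; - $\mathsf{fix}(\pi)=\mathsf{bad}(\Upsilon(\pi))$ and $\mathsf{drop}(\pi)=\mathsf{des}(\Upsilon(\pi))$. Consequently, for every $n\ge 0$ and $t\ge1$, $$\sum_{\pi\in\mathfrak S_n^t(321)}r^{\mathsf{fix}(\pi)}x^{\mathsf{drop}(\pi)}=\sum_{\pi\in\mathfrak S_n^t(213)}r^{\mathsf{bad}(\pi)}x^{\mathsf{des}(\pi)}$$ as polynomials in $r$ and $x$ with integer coefficients, and in particular $|\mathfrak S_n^t(321)|=|\mathfrak S_n^t(213)|$ (the Zhang–Kitaev conjecture). -/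

import Mathlib

/-! Permutations of `[n]` are elements of `Equiv.Perm (Fin n)`; positions and letters are numbered
`0, …, n - 1` in place of `1, …, n`, a common shift that changes none of the notions below. -/

namespace StackSorting

/-- `π` avoids the pattern `p`: there are no positions `i₁ < ⋯ < iₖ` such that
`π_{i₁} ⋯ π_{iₖ}` is order isomorphic to `p`. -/
def Avoids {n k : ℕ} (π : Equiv.Perm (Fin n)) (p : Equiv.Perm (Fin k)) : Prop :=
  ¬ ∃ i : Fin k → Fin n, StrictMono i ∧ ∀ a b : Fin k, π (i a) < π (i b) ↔ p a < p b

instance {n k : ℕ} (π : Equiv.Perm (Fin n)) (p : Equiv.Perm (Fin k)) :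
    Decidable (Avoids π p) := by
  unfold Avoids StrictMono
  infer_instance

/-- The pattern `321`. -/
def pattern321 : Equiv.Perm (Fin 3) := Fin.revPerm

/-- The pattern `213`. -/
def pattern213 : Equiv.Perm (Fin 3) := Equiv.swap 0 1

theorem pattern321_word : ⇑pattern321 = ![2, 1, 0] := by decide

theorem pattern213_word : ⇑pattern213 = ![1, 0, 2] := by decide

/-- The stack-sorting operation on words: `S(∅) = ∅`, and `S(u m v) = S(u) S(v) m`
if `m` is the largest letter (see `stackSort_append_cons`). -/
def stackSort {α : Type*} [LinearOrder α] (w : List α) : List α :=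
  match h : w.max? with
  | none => []
  | some m =>
      stackSort (w.takeWhile (fun a => decide (a ≠ m))) ++
        stackSort (w.dropWhile (fun a => decide (a ≠ m))).tail ++ [m]
termination_by w.length
decreasing_by
  all_goals
    have hm : m ∈ w := List.max?_mem h
    have hlen := congrArg List.length
      (List.takeWhile_append_dropWhile (p := fun a => decide (a ≠ m)) (l := w))
    have hd : w.dropWhile (fun a => decide (a ≠ m)) ≠ [] := by
      intro h0
      have := (List.dropWhile_eq_nil_iff.mp h0) m hm
      simp at this
    have hpos := List.length_pos_of_ne_nil hd
    simp only [List.length_append] at hlen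
    try rw [List.length_tail]
    omega

theorem stackSort_nil {α : Type*} [LinearOrder α] : stackSort ([] : List α) = [] := by
  unfold stackSort
  simp

theorem stackSort_append_cons {α : Type*} [LinearOrder α] (u v : List α) (m : α)
    (hu : ∀ a ∈ u, a < m) (hv : ∀ a ∈ v, a < m) :
    stackSort (u ++ m :: v) = stackSort u ++ stackSort v ++ [m] := by
  have hmax : (u ++ m :: v).max? = some m := by
    rw [List.max?_eq_some_iff]
    refine ⟨by simp, fun b hb => ?_⟩
    rcases List.mem_append.mp hb with h | h
    · exact (hu b h).le
    · rcases List.mem_cons.mp h with h | h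
      · exact h.le
      · exact (hv b h).le
  have ht : (u ++ m :: v).takeWhile (fun a => decide (a ≠ m)) = u := by
    rw [List.takeWhile_append_of_pos (fun a ha => by simpa using (hu a ha).ne)]
    simp
  have hd : (u ++ m :: v).dropWhile (fun a => decide (a ≠ m)) = m :: v := by
    rw [List.dropWhile_append_of_pos (fun a ha => by simpa using (hu a ha).ne)]
    simp
  rw [stackSort]
  split
  · rename_i h
    rw [hmax] at h
    cases h
  · rename_i m' h
    rw [hmax] at h
    cases h
    rw [ht, hd, List.tail_cons]

/-- `π` is `t`-stack-sortable: applying the stack-sorting operation `t` times to the word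
`π₁ π₂ ⋯ πₙ` gives the word of the identity permutation. -/
def IsStackSortable {n : ℕ} (t : ℕ) (π : Equiv.Perm (Fin n)) : Prop :=
  stackSort^[t] (List.ofFn π) = List.finRange n

instance {n : ℕ} (t : ℕ) (π : Equiv.Perm (Fin n)) : Decidable (IsStackSortable t π) := by
  unfold IsStackSortable
  infer_instance

/-- The set of `t`-stack-sortable permutations of `[n]` that avoid `p`. -/
def sortableAvoiding (n t : ℕ) {k : ℕ} (p : Equiv.Perm (Fin k)) :
    Finset (Equiv.Perm (Fin n)) :=
  {π | IsStackSortable t π ∧ Avoids π p}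

/-- The number of fixed points. -/
def fix {n : ℕ} (π : Equiv.Perm (Fin n)) : ℕ :=
  Finset.card {i : Fin n | π i = i}

/-- The number of drops. -/
def drop {n : ℕ} (π : Equiv.Perm (Fin n)) : ℕ :=
  Finset.card {i : Fin n | π i < i}

/-- The number of descent tops. -/
def des {n : ℕ} (π : Equiv.Perm (Fin n)) : ℕ :=
  Finset.card {i : Fin n | ∃ j : Fin n, j.val = i.val + 1 ∧ π i > π j}

/-- The number of bad points: right-to-left minima `π_i` such that `i` is the first position
or `π_{i-1} < π_i`. -/
def bad {n : ℕ} (π : Equiv.Perm (Fin n)) : ℕ :=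
  Finset.card {i : Fin n | (∀ j : Fin n, j > i → π i < π j) ∧
    (i.val = 0 ∨ ∃ j : Fin n, j.val + 1 = i.val ∧ π j < π i)}

end StackSorting

/-! Both classes are encoded by the same integer sequences (`IsCode`), and the bijection matches
equal codes. For a 321-avoiding `p`, the code at `k` counts the letters before position `k` that
exceed the least letter from `k` on. For a 213-avoiding `p`, only those not exceeding `p (k - 1)`
are counted.

An inversion `b … a` survives a pass iff a letter larger than `b` lies between them
(`inversion_stackSort_iff`). In both classes it therefore survives `t` passes iff an increasing
chain of `t + 1` letters starting at `b` precedes `a` (`HasChain.iterate`, `hasChain_of_iterate`),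
so `t`-sortability says that the code never exceeds `t`. A fixed point and a bad point at `i` both
mean that the code vanishes at `i` and `i + 1`. A drop at `i` and a descent from `i - 1` to `i` both
mean that the code is positive at `i` and does not rise at the next step.

Every code comes from exactly one 321-avoider, by explicit reconstruction (`exists_code321_eq`,
`code321_injective`). On 213-avoiders the code is injective (`code213_injective`), and a count gives
surjectivity. Permutations are extended to `ℕ` by the identity, so that every tail has a minimum. -/

namespace StackSorting

/-! ### Order of letters in words, and inversions under stack-sorting. -/

section Words

variable {α : Type*}

theorem pair_sublist_append {u v : List α} {x y : α} :
    [x, y].Sublist (u ++ v) ↔ [x, y].Sublist u ∨ (x ∈ u ∧ y ∈ v) ∨ [x, y].Sublist v := by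
  constructor
  · intro h
    obtain ⟨l₁, l₂, h₁, h₂, h₃⟩ := List.sublist_append_iff.mp h
    rcases l₁ with _ | ⟨a, _ | ⟨b, _ | ⟨c, l⟩⟩⟩
    · simp only [List.nil_append] at h₁
      subst h₁
      exact Or.inr (Or.inr h₃)
    · simp only [List.cons_append, List.nil_append, List.cons.injEq] at h₁
      obtain ⟨rfl, rfl⟩ := h₁
      exact Or.inr (Or.inl ⟨List.singleton_sublist.mp h₂, List.singleton_sublist.mp h₃⟩)
    · simp only [List.cons_append, List.nil_append, List.cons.injEq] at h₁
      obtain ⟨rfl, rfl, -⟩ := h₁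
      exact Or.inl h₂
    · simp at h₁
  · rintro (h | ⟨hx, hy⟩ | h)
    · exact h.trans (List.sublist_append_left _ _)
    · exact (List.singleton_sublist.mpr hx).append (List.singleton_sublist.mpr hy)
    · exact h.trans (List.sublist_append_right _ _)

theorem pair_sublist_cons {v : List α} {x y m : α} :
    [x, y].Sublist (m :: v) ↔ (x = m ∧ y ∈ v) ∨ [x, y].Sublist v := by
  have h := pair_sublist_append (u := [m]) (v := v) (x := x) (y := y)
  have h' : ¬ [x, y].Sublist [m] := fun h => by simpa using h.length_le
  simpa [h'] using h

theorem mem_left_of_pair_sublist {w : List α} {x y : α} (h : [x, y].Sublist w) : x ∈ w :=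
  h.subset (by simp)

theorem mem_right_of_pair_sublist {w : List α} {x y : α} (h : [x, y].Sublist w) : y ∈ w :=
  h.subset (by simp)

theorem pair_sublist_total {w : List α} {x y : α} (hx : x ∈ w) (hy : y ∈ w) (hxy : x ≠ y) :
    [x, y].Sublist w ∨ [y, x].Sublist w := by
  induction w with
  | nil => simp at hx
  | cons m v ih =>
    simp only [pair_sublist_cons, List.mem_cons] at *
    grind

theorem not_pair_sublist_swap {w : List α} (hw : w.Nodup) {x y : α} (h : [x, y].Sublist w) :
    ¬ [y, x].Sublist w := by
  induction w with
  | nil => simp at h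
  | cons m v ih =>
    rw [List.nodup_cons] at hw
    rw [pair_sublist_cons] at h ⊢
    have h1 := fun h : [x, y].Sublist v => mem_right_of_pair_sublist h
    have h2 := fun h : [x, y].Sublist v => mem_left_of_pair_sublist h
    have h3 := fun h : [y, x].Sublist v => mem_right_of_pair_sublist h
    grind

theorem pair_sublist_trans {w : List α} (hw : w.Nodup) {x y z : α} (h : [x, y].Sublist w)
    (h' : [y, z].Sublist w) : [x, z].Sublist w := by
  induction w with
  | nil => simp at h
  | cons m v ih =>
    rw [List.nodup_cons] at hw
    rw [pair_sublist_cons] at h h' ⊢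
    have h1 := fun h : [x, y].Sublist v => mem_right_of_pair_sublist h
    have h2 := fun h : [y, z].Sublist v => mem_right_of_pair_sublist h
    grind

variable [LinearOrder α]

theorem exists_eq_append_max_cons {w : List α} (hw : w.Nodup) (h : w ≠ []) :
    ∃ u m v, w = u ++ m :: v ∧ (∀ a ∈ u, a < m) ∧ ∀ a ∈ v, a < m := by
  obtain ⟨m, hm, hmax⟩ := Finset.exists_max_image w.toFinset id
    (by simpa [Finset.nonempty_iff_ne_empty] using h)
  obtain ⟨u, v, rfl⟩ := List.append_of_mem (List.mem_toFinset.mp hm)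
  refine ⟨u, m, v, rfl, fun a ha => ?_, fun a ha => ?_⟩
  · refine lt_of_le_of_ne (hmax a (by simp [ha])) ?_
    rintro rfl
    exact (List.nodup_append.mp hw).2.2 a ha a (by simp) rfl
  · refine lt_of_le_of_ne (hmax a (by simp [ha])) ?_
    rintro rfl
    exact (List.nodup_cons.mp hw.of_append_right).1 ha

@[elab_as_elim]
theorem nodup_induction {P : (w : List α) → w.Nodup → Prop} (nil : P [] List.nodup_nil)
    (append : ∀ (u : List α) (m : α) (v : List α) (hw : (u ++ m :: v).Nodup),
      (∀ a ∈ u, a < m) → (∀ a ∈ v, a < m) → P u hw.of_append_left →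
      P v (List.nodup_cons.mp hw.of_append_right).2 → P (u ++ m :: v) hw)
    {w : List α} (hw : w.Nodup) : P w hw := by
  induction h : w.length using Nat.strong_induction_on generalizing w with
  | _ k ih =>
    by_cases hn : w = []
    · subst hn
      exact nil
    · obtain ⟨u, m, v, rfl, hu, hv⟩ := exists_eq_append_max_cons hw hn
      simp only [List.length_append, List.length_cons] at h
      exact append u m v hw hu hv
        (ih u.length (by omega) _ rfl)
        (ih v.length (by omega) _ rfl)

theorem stackSort_perm {w : List α} (hw : w.Nodup) : (stackSort w).Perm w := by
  induction hw using nodup_induction with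
  | nil => rw [stackSort_nil]
  | append u m v hw hu hv ihu ihv =>
    rw [stackSort_append_cons u v m hu hv, List.append_assoc]
    exact ihu.append ((List.perm_append_singleton m _).trans (ihv.cons m))

theorem stackSort_nodup {w : List α} (hw : w.Nodup) : (stackSort w).Nodup :=
  (stackSort_perm hw).nodup_iff.mpr hw

theorem iterate_stackSort_perm {w : List α} (hw : w.Nodup) (t : ℕ) :
    (stackSort^[t] w).Perm w := by
  induction t with
  | zero => rfl
  | succ t ih =>
    rw [Function.iterate_succ_apply']
    exact (stackSort_perm (ih.nodup_iff.mpr hw)).trans ih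

theorem iterate_stackSort_nodup {w : List α} (hw : w.Nodup) (t : ℕ) :
    (stackSort^[t] w).Nodup :=
  (iterate_stackSort_perm hw t).nodup_iff.mpr hw

/-- An inversion survives the stack-sorting operation if and only if it is part of an occurrence
of the pattern `231`. -/
theorem inversion_stackSort_iff {w : List α} (hw : w.Nodup) {a b : α} (hab : a < b) :
    [b, a].Sublist (stackSort w) ↔ ∃ c, b < c ∧ [b, c].Sublist w ∧ [c, a].Sublist w := by
  induction hw using nodup_induction with
  | nil => simp [stackSort_nil]
  | append u m v hw hu hv ihu ihv =>
    have hpu := stackSort_perm hw.of_append_left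
    have hpv := stackSort_perm (List.nodup_cons.mp hw.of_append_right).2
    have hs : ¬ [b, a].Sublist [m] := fun h => by simpa using h.length_le
    rw [stackSort_append_cons u v m hu hv]
    simp only [pair_sublist_append, pair_sublist_cons, ihu, ihv, List.mem_append, hpu.mem_iff,
      hpv.mem_iff, List.mem_cons, List.not_mem_nil, or_false]
    constructor
    · rintro ((⟨c, h₁, h₂, h₃⟩ | ⟨h₁, h₂⟩ | ⟨c, h₁, h₂, h₃⟩) | ⟨h₁ | h₁, h₂⟩ | h)
      · exact ⟨c, h₁, Or.inl h₂, Or.inl h₃⟩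
      · exact ⟨m, hu b h₁, Or.inr (Or.inl ⟨h₁, Or.inl rfl⟩), Or.inr (Or.inr (Or.inl ⟨rfl, h₂⟩))⟩
      · exact ⟨c, h₁, Or.inr (Or.inr (Or.inr h₂)), Or.inr (Or.inr (Or.inr h₃))⟩
      · exact absurd (hu b h₁) (by rw [← h₂]; exact hab.not_gt)
      · exact absurd (hv b h₁) (by rw [← h₂]; exact hab.not_gt)
      · simp at h
    · rintro ⟨c, hbc, h₁, h₂⟩
      have hmu : m ∉ u := fun h => (hu m h).false
      have hmv : m ∉ v := fun h => (hv m h).false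
      have hd : ∀ x ∈ u, x ∉ v := fun x hx hx' =>
        (List.nodup_append.mp hw).2.2 x hx x (List.mem_cons_of_mem _ hx') rfl
      rcases h₁ with h₁ | ⟨h₁, h₃⟩ | ⟨h₁, h₃⟩ | h₁
      · rcases h₂ with h₂ | ⟨h₂, h₄⟩ | ⟨h₂, h₄⟩ | h₂
        · exact Or.inl (Or.inl ⟨c, hbc, h₁, h₂⟩)
        · rcases h₄ with rfl | h₄
          · exact absurd (hu b (mem_left_of_pair_sublist h₁)) hab.not_gt
          · exact Or.inl (Or.inr (Or.inl ⟨mem_left_of_pair_sublist h₁, h₄⟩))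
        · exact absurd (mem_right_of_pair_sublist h₁) (h₂ ▸ hmu)
        · exact absurd (mem_left_of_pair_sublist h₂) (hd _ (mem_right_of_pair_sublist h₁))
      · rcases h₂ with h₂ | ⟨h₂, h₄⟩ | ⟨h₂, h₄⟩ | h₂
        · rcases h₃ with rfl | h₃
          · exact absurd (mem_left_of_pair_sublist h₂) hmu
          · exact absurd h₃ (hd _ (mem_left_of_pair_sublist h₂))
        · rcases h₃ with rfl | h₃
          · exact absurd h₂ hmu
          · exact absurd h₃ (hd _ h₂)
        · exact Or.inl (Or.inr (Or.inl ⟨h₁, h₄⟩))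
        · exact Or.inl (Or.inr (Or.inl ⟨h₁, mem_right_of_pair_sublist h₂⟩))
      · exact absurd (hv c h₃) (by rw [← h₁]; exact hbc.not_gt)
      · have hc := mem_right_of_pair_sublist h₁
        rcases h₂ with h₂ | ⟨h₂, h₄⟩ | ⟨h₂, h₄⟩ | h₂
        · exact absurd hc (hd _ (mem_left_of_pair_sublist h₂))
        · exact absurd hc (hd _ h₂)
        · exact absurd hc (h₂ ▸ hmv)
        · exact Or.inl (Or.inr (Or.inr ⟨c, hbc, h₁, h₂⟩))

theorem inversion_of_inversion_stackSort {w : List α} (hw : w.Nodup) {a b : α} (hab : a < b)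
    (h : [b, a].Sublist (stackSort w)) : [b, a].Sublist w := by
  obtain ⟨c, -, h₁, h₂⟩ := (inversion_stackSort_iff hw hab).mp h
  exact pair_sublist_trans hw h₁ h₂

theorem inversion_of_inversion_iterate {w : List α} (hw : w.Nodup) {a b : α} (hab : a < b)
    {t : ℕ} (h : [b, a].Sublist (stackSort^[t] w)) : [b, a].Sublist w := by
  induction t with
  | zero => exact h
  | succ t ih =>
    rw [Function.iterate_succ_apply'] at h
    exact ih (inversion_of_inversion_stackSort (iterate_stackSort_nodup hw t) hab h)

theorem ascent_stackSort {w : List α} (hw : w.Nodup) {a b : α} (hab : a < b)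
    (h : [a, b].Sublist w) : [a, b].Sublist (stackSort w) := by
  have hp := stackSort_perm hw
  refine (pair_sublist_total (hp.mem_iff.mpr (mem_left_of_pair_sublist h))
    (hp.mem_iff.mpr (mem_right_of_pair_sublist h)) hab.ne).resolve_right fun h' => ?_
  exact not_pair_sublist_swap hw h (inversion_of_inversion_stackSort hw hab h')

/-- The word `w` has a subword `b = b₀ < b₁ < ⋯ < bᵢ` followed by a letter `a < b`. -/
def HasChain (w : List α) : ℕ → α → α → Prop
  | 0, b, a => a < b ∧ [b, a].Sublist w
  | i + 1, b, a => a < b ∧ ∃ c, b < c ∧ [b, c].Sublist w ∧ HasChain w i c a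

theorem HasChain.lt {w : List α} {i : ℕ} {b a : α} (h : HasChain w i b a) : a < b := by
  cases i <;> exact h.1

theorem HasChain.sublist {w : List α} (hw : w.Nodup) {i : ℕ} {b a : α} (h : HasChain w i b a) :
    [b, a].Sublist w := by
  induction i generalizing b with
  | zero => exact h.2
  | succ i ih =>
    obtain ⟨-, c, -, h₁, h₂⟩ := h
    exact pair_sublist_trans hw h₁ (ih h₂)

/-- A pass costs the chain its last letter: ascents stay ascents, and that letter, lying between its
predecessor and `a`, preserves their inversion. -/
theorem HasChain.stackSort {w : List α} (hw : w.Nodup) {i : ℕ} {b a : α}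
    (h : HasChain w (i + 1) b a) : HasChain (stackSort w) i b a := by
  induction i generalizing b with
  | zero =>
    obtain ⟨hab, c, hbc, h₁, h₂⟩ := h
    exact ⟨hab, (inversion_stackSort_iff hw hab).mpr ⟨c, hbc, h₁, h₂.2⟩⟩
  | succ i ih =>
    obtain ⟨hab, c, hbc, h₁, h₂⟩ := h
    exact ⟨hab, c, hbc, ascent_stackSort hw hbc h₁, ih h₂⟩

theorem HasChain.iterate {w : List α} (hw : w.Nodup) {i : ℕ} {b a : α}
    (h : HasChain w i b a) : [b, a].Sublist (StackSorting.stackSort^[i] w) := by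
  induction i generalizing w with
  | zero => exact h.2
  | succ i ih =>
    rw [Function.iterate_succ_apply]
    exact ih (stackSort_nodup hw) (h.stackSort hw)

/-- Each chain letter `d > c` precedes `b`, since `c b d` would otherwise be a 213; so `b` can
replace `a` at the end. -/
theorem HasChain.of_avoids_213 {w : List α}
    (hav : ∀ x y z, x < y → y < z → [y, x].Sublist w → ¬ [x, z].Sublist w)
    {i : ℕ} {c b a : α} (h : HasChain w i c a) (hbc : b < c) (hcb : [c, b].Sublist w) :
    HasChain w i c b := by
  induction i generalizing c with
  | zero => exact ⟨hbc, hcb⟩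
  | succ i ih =>
    obtain ⟨-, d, hcd, h₁, h₂⟩ := h
    refine ⟨hbc, d, hcd, h₁, ih h₂ (hbc.trans hcd) ?_⟩
    refine (pair_sublist_total (mem_right_of_pair_sublist h₁) (mem_right_of_pair_sublist hcb)
      (hbc.trans hcd).ne').resolve_right fun h' => ?_
    exact hav b c d hbc hcd hcb h'

theorem hasChain_of_iterate {w : List α} (hw : w.Nodup)
    (hav : (∀ x y z, x < y → y < z → [z, y].Sublist w → ¬ [y, x].Sublist w) ∨
      ∀ x y z, x < y → y < z → [y, x].Sublist w → ¬ [x, z].Sublist w)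
    {i : ℕ} {b a : α} (hab : a < b) (h : [b, a].Sublist (stackSort^[i] w)) :
    HasChain w i b a := by
  induction i generalizing b with
  | zero => exact ⟨hab, h⟩
  | succ i ih =>
    have hba := inversion_of_inversion_iterate hw hab h
    have hn := iterate_stackSort_nodup hw i
    rw [Function.iterate_succ_apply'] at h
    obtain ⟨c, hbc, h₁, h₂⟩ := (inversion_stackSort_iff hn hab).mp h
    have hc := ih (hab.trans hbc) h₂
    refine ⟨hab, c, hbc, ?_, hc⟩
    refine (pair_sublist_total (mem_left_of_pair_sublist hba)
      (mem_left_of_pair_sublist (hc.sublist hw)) hbc.ne).resolve_right fun hcb => ?_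
    -- If `c` preceded `b`, either `c b a` would be a 321, or the chain from `c` could end at `b`,
    -- and the inversion of `c` and `b` would survive `i` passes, against `h₁`.
    rcases hav with hav | hav
    · exact hav a b c hab hbc hcb hba
    · exact not_pair_sublist_swap hn h₁ ((hc.of_avoids_213 hav hbc hcb).iterate hw)

end Words

/-! ### Sortability and avoidance in terms of positions. -/

theorem pair_sublist_ofFn {n : ℕ} (π : Equiv.Perm (Fin n)) (x y : Fin n) :
    [π x, π y].Sublist (List.ofFn π) ↔ x < y := by
  have key : ∀ x y : Fin n, x < y → [π x, π y].Sublist (List.ofFn π) := by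
    intro x y h
    have h1 : [x, y].Sublist (List.finRange n) := by
      have := List.pairwise_lt_finRange n
      rcases pair_sublist_total (List.mem_finRange x) (List.mem_finRange y) h.ne with h' | h'
      · exact h'
      · exact absurd (List.pairwise_iff_forall_sublist.mp this h') h.not_gt
    simpa [List.ofFn_eq_map] using h1.map π
  refine ⟨fun h => ?_, key x y⟩
  by_contra hn
  have hw : (List.ofFn π).Nodup := List.nodup_ofFn.mpr π.injective
  rcases (not_lt.mp hn).eq_or_lt with rfl | h'
  · exact not_pair_sublist_swap hw h h
  · exact not_pair_sublist_swap hw h (key y x h')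

theorem isStackSortable_iff {n : ℕ} (π : Equiv.Perm (Fin n)) (t : ℕ) :
    IsStackSortable t π ↔ ∀ b a, a < b → ¬ [b, a].Sublist (stackSort^[t] (List.ofFn π)) := by
  have hw : (List.ofFn π).Nodup := List.nodup_ofFn.mpr π.injective
  unfold IsStackSortable
  constructor
  · intro h b a hab h'
    rw [h] at h'
    exact (List.pairwise_iff_forall_sublist.mp (List.pairwise_lt_finRange n) h').not_gt hab
  · intro h
    have hp : (stackSort^[t] (List.ofFn π)).Perm (List.finRange n) := by
      refine (iterate_stackSort_perm hw t).trans ?_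
      refine (List.perm_ext_iff_of_nodup hw (List.nodup_finRange n)).mpr fun a => ?_
      simp [List.mem_ofFn, π.surjective a]
    refine hp.eq_of_pairwise' (r := (· ≤ ·)) ?_ (List.pairwise_le_finRange n)
    rw [List.pairwise_iff_forall_sublist]
    intro a b hab
    by_contra hn
    exact h a b (not_le.mp hn) hab

/-- The extension of a permutation of `{0, …, n - 1}` to a permutation of `ℕ` that fixes all other
numbers. -/
def natPerm {n : ℕ} (π : Equiv.Perm (Fin n)) : Equiv.Perm ℕ :=
  π.extendDomain Fin.equivSubtype

section natPerm

variable {n : ℕ} (π : Equiv.Perm (Fin n))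

theorem natPerm_apply (i : Fin n) : natPerm π i = π i :=
  π.extendDomain_apply_image Fin.equivSubtype i

theorem natPerm_of_le {i : ℕ} (h : n ≤ i) : natPerm π i = i :=
  π.extendDomain_apply_not_subtype Fin.equivSubtype (not_lt.mpr h)

theorem natPerm_lt {i : ℕ} (h : i < n) : natPerm π i < n := by
  have := natPerm_apply π ⟨i, h⟩
  simp only at this
  omega

theorem natPerm_injective : Function.Injective (natPerm (n := n)) := by
  intro π σ h
  ext i
  rw [← natPerm_apply, ← natPerm_apply, h]

theorem lt_of_natPerm_inversion {i j : ℕ} (hij : i < j) (h : natPerm π j < natPerm π i) :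
    j < n := by
  by_contra hj
  have h1 := natPerm_of_le π (not_lt.mp hj)
  by_cases hi : i < n
  · have := natPerm_lt π hi
    omega
  · have := natPerm_of_le π (not_lt.mp hi)
    omega

end natPerm

theorem strictMono_vecCons_three {n : ℕ} {i j k : Fin n} (hij : i < j) (hjk : j < k) :
    StrictMono ![i, j, k] := by
  rw [Fin.strictMono_iff_lt_succ]
  intro a
  fin_cases a
  · exact hij
  · exact hjk

theorem avoids_pattern321_iff {n : ℕ} (π : Equiv.Perm (Fin n)) :
    Avoids π pattern321 ↔ ∀ i j k : ℕ, i < j → j < k → natPerm π k < natPerm π j →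
      ¬ natPerm π j < natPerm π i := by
  constructor
  · intro h i j k hij hjk h₁ h₂
    have hk := lt_of_natPerm_inversion π hjk h₁
    refine h ⟨![⟨i, by omega⟩, ⟨j, by omega⟩, ⟨k, hk⟩], strictMono_vecCons_three hij hjk, ?_⟩
    have e₁ := natPerm_apply π ⟨i, by omega⟩
    have e₂ := natPerm_apply π ⟨j, by omega⟩
    have e₃ := natPerm_apply π ⟨k, hk⟩
    simp only at e₁ e₂ e₃
    rw [pattern321_word]
    intro a b
    fin_cases a <;> fin_cases b <;> simp [Fin.lt_def, ← e₁, ← e₂, ← e₃] <;> omega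
  · rintro h ⟨f, hf, hp⟩
    have h₁ := (hp 2 1).mpr (by decide)
    have h₂ := (hp 1 0).mpr (by decide)
    rw [Fin.lt_def, ← natPerm_apply, ← natPerm_apply] at h₁ h₂
    exact h (f 0) (f 1) (f 2) (hf (by decide)) (hf (by decide)) h₁ h₂

theorem avoids_pattern213_iff {n : ℕ} (π : Equiv.Perm (Fin n)) :
    Avoids π pattern213 ↔ ∀ i j k : ℕ, i < j → j < k → k < n → natPerm π j < natPerm π i →
      ¬ natPerm π i < natPerm π k := by
  constructor
  · intro h i j k hij hjk hk h₁ h₂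
    refine h ⟨![⟨i, by omega⟩, ⟨j, by omega⟩, ⟨k, hk⟩], strictMono_vecCons_three hij hjk, ?_⟩
    have e₁ := natPerm_apply π ⟨i, by omega⟩
    have e₂ := natPerm_apply π ⟨j, by omega⟩
    have e₃ := natPerm_apply π ⟨k, hk⟩
    simp only at e₁ e₂ e₃
    rw [pattern213_word]
    intro a b
    fin_cases a <;> fin_cases b <;> simp [Fin.lt_def, ← e₁, ← e₂, ← e₃] <;> omega
  · rintro h ⟨f, hf, hp⟩
    have h₁ := (hp 1 0).mpr (by decide)
    have h₂ := (hp 0 2).mpr (by decide)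
    rw [Fin.lt_def, ← natPerm_apply, ← natPerm_apply] at h₁ h₂
    exact h (f 0) (f 1) (f 2) (hf (by decide)) (hf (by decide)) (f 2).isLt h₁ h₂

/-- Some letter of `p` is preceded by an increasing sequence of more than `t` larger letters. -/
def HasIncreasingBefore (p : ℕ → ℕ) (t : ℕ) : Prop :=
  ∃ (B : Finset ℕ) (j : ℕ), (∀ i ∈ B, i < j ∧ p j < p i) ∧ StrictMonoOn p B ∧ t < B.card

/-- The lower bounds by the position and letter of `b` are what the induction needs in order to
prepend a letter. -/
theorem HasChain.exists_finset {n : ℕ} (π : Equiv.Perm (Fin n)) {t : ℕ} {b a : Fin n}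
    (h : HasChain (List.ofFn π) t b a) :
    ∃ B : Finset ℕ, (π.symm b : ℕ) ∈ B ∧ (∀ i ∈ B, (π.symm b : ℕ) ≤ i ∧ i < π.symm a ∧
      (b : ℕ) ≤ natPerm π i) ∧ StrictMonoOn (natPerm π) B ∧ t < B.card := by
  have e := natPerm_apply π (π.symm b)
  rw [Equiv.apply_symm_apply] at e
  have hs : ∀ x y, [x, y].Sublist (List.ofFn π) → π.symm x < π.symm y := by
    intro x y hxy
    rw [← pair_sublist_ofFn π]
    simpa using hxy
  induction t generalizing b with
  | zero =>
    refine ⟨{(π.symm b : ℕ)}, by simp, ?_, by simp, by simp⟩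
    intro i hi
    rw [Finset.mem_singleton] at hi
    subst hi
    exact ⟨le_rfl, hs _ _ h.2, e.ge⟩
  | succ t ih =>
    obtain ⟨-, c, hbc, hc, h⟩ := h
    have ec := natPerm_apply π (π.symm c)
    rw [Equiv.apply_symm_apply] at ec
    obtain ⟨B, hcB, hB, hm, ht⟩ := ih h ec
    have hc' : (π.symm b : ℕ) < π.symm c := hs _ _ hc
    have hbc' : (b : ℕ) < c := hbc
    have hbB : (π.symm b : ℕ) ∉ B := fun hb => by
      have := (hB _ hb).1
      omega
    refine ⟨insert (π.symm b : ℕ) B, Finset.mem_insert_self _ _, ?_, ?_, ?_⟩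
    · intro i hi
      rcases Finset.mem_insert.mp hi with rfl | hi
      · have := hB _ hcB
        omega
      · have := hB _ hi
        omega
    · intro i hi j hj hij
      rw [Finset.mem_coe, Finset.mem_insert] at hi hj
      rcases hi with rfl | hi <;> rcases hj with rfl | hj
      · omega
      · have := hB _ hj
        omega
      · have := hB _ hi
        omega
      · exact hm hi hj hij
    · rw [Finset.card_insert_of_notMem hbB]
      omega

theorem exists_hasChain {n : ℕ} (π : Equiv.Perm (Fin n)) {t : ℕ} {B : Finset ℕ} {j : Fin n}
    (hB : ∀ i ∈ B, i < j ∧ natPerm π j < natPerm π i) (hm : StrictMonoOn (natPerm π) B)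
    (ht : t < B.card) :
    ∃ i : Fin n, (i : ℕ) ∈ B ∧ HasChain (List.ofFn π) t (π i) (π j) := by
  induction t generalizing B with
  | zero =>
    obtain ⟨i, hi⟩ := Finset.card_pos.mp ht
    obtain ⟨h₁, h₂⟩ := hB i hi
    refine ⟨⟨i, by omega⟩, hi, ?_, (pair_sublist_ofFn π _ _).mpr h₁⟩
    rwa [Fin.lt_def, ← natPerm_apply, ← natPerm_apply]
  | succ t ih =>
    have hne : B.Nonempty := Finset.card_pos.mp (by omega)
    have hi := B.min'_mem hne
    obtain ⟨h₁, h₂⟩ := hB _ hi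
    obtain ⟨k, hk, hc⟩ := ih (B := B.erase (B.min' hne))
      (fun i hi => hB i (Finset.mem_of_mem_erase hi))
      (hm.mono (by simp))
      (by rw [Finset.card_erase_of_mem hi]; omega)
    have hlt := B.min'_lt_of_mem_erase_min' hne hk
    refine ⟨⟨B.min' hne, by omega⟩, hi, ?_, π k, ?_, (pair_sublist_ofFn π _ _).mpr hlt, hc⟩
    · rwa [Fin.lt_def, ← natPerm_apply, ← natPerm_apply]
    · rw [Fin.lt_def, ← natPerm_apply, ← natPerm_apply]
      exact hm hi (Finset.mem_of_mem_erase hk) hlt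

theorem isStackSortable_iff_of_avoids {n : ℕ} (π : Equiv.Perm (Fin n))
    (h : Avoids π pattern321 ∨ Avoids π pattern213) (t : ℕ) :
    IsStackSortable t π ↔ ¬ HasIncreasingBefore (natPerm π) t := by
  have hw : (List.ofFn π).Nodup := List.nodup_ofFn.mpr π.injective
  have hs : ∀ x y, [x, y].Sublist (List.ofFn π) → π.symm x < π.symm y := by
    intro x y hxy
    rw [← pair_sublist_ofFn π]
    simpa using hxy
  have e : ∀ x, natPerm π (π.symm x) = x := fun x => by simp [natPerm_apply]
  rw [isStackSortable_iff, ← not_iff_not, not_not]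
  push Not
  constructor
  · rintro ⟨b, a, hab, hba⟩
    have hc : HasChain (List.ofFn π) t b a := by
      refine hasChain_of_iterate hw (h.imp (fun h => ?_) fun h => ?_) hab hba
      · rw [avoids_pattern321_iff] at h
        intro x y z hxy hyz h₁ h₂
        refine h _ _ _ (hs _ _ h₁) (hs _ _ h₂) ?_ ?_ <;> rw [e, e] <;> assumption
      · rw [avoids_pattern213_iff] at h
        intro x y z hxy hyz h₁ h₂
        refine h _ _ _ (hs _ _ h₁) (hs _ _ h₂) (π.symm z).isLt ?_ ?_ <;> rw [e, e] <;> assumption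
    obtain ⟨B, -, hB, hm, ht⟩ := hc.exists_finset π
    refine ⟨B, π.symm a, fun i hi => ⟨(hB i hi).2.1, ?_⟩, hm, ht⟩
    rw [e]
    exact lt_of_lt_of_le hab (hB i hi).2.2
  · rintro ⟨B, j, hB, hm, ht⟩
    obtain ⟨i, hi⟩ := Finset.card_pos.mp (by omega : 0 < B.card)
    have hj := lt_of_natPerm_inversion π (hB i hi).1 (hB i hi).2
    obtain ⟨k, -, hc⟩ := exists_hasChain π (j := ⟨j, hj⟩) hB hm ht
    exact ⟨_, _, hc.lt, hc.iterate hw⟩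

/-! ### Suffix minima and codes. -/

/-- The least value of `p` at a position that is at least `k`. -/
noncomputable def suffixMin (p : ℕ → ℕ) (k : ℕ) : ℕ :=
  sInf (p '' Set.Ici k)

theorem suffixMin_le (p : ℕ → ℕ) {k i : ℕ} (h : k ≤ i) : suffixMin p k ≤ p i :=
  Nat.sInf_le ⟨i, h, rfl⟩

theorem exists_eq_suffixMin (p : ℕ → ℕ) (k : ℕ) : ∃ i, k ≤ i ∧ p i = suffixMin p k :=
  Nat.sInf_mem (Set.nonempty_Ici.image p)

theorem suffixMin_mono (p : ℕ → ℕ) : Monotone (suffixMin p) := by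
  intro k l h
  obtain ⟨i, hi, e⟩ := exists_eq_suffixMin p l
  exact e ▸ suffixMin_le p (h.trans hi)

theorem suffixMin_eq_min (p : ℕ → ℕ) (k : ℕ) :
    suffixMin p k = min (p k) (suffixMin p (k + 1)) := by
  refine le_antisymm (le_min (suffixMin_le p le_rfl) (suffixMin_mono p k.le_succ)) ?_
  obtain ⟨i, hi, e⟩ := exists_eq_suffixMin p k
  rw [← e]
  rcases hi.eq_or_lt with rfl | hi
  · exact min_le_left _ _
  · exact (min_le_right _ _).trans (suffixMin_le p hi)

theorem apply_ne_suffixMin_succ (p : Equiv.Perm ℕ) (k : ℕ) : p k ≠ suffixMin p (k + 1) := by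
  obtain ⟨i, hi, e⟩ := exists_eq_suffixMin p (k + 1)
  rw [← e]
  exact p.injective.ne (by omega)

theorem lt_suffixMin_succ_iff (p : Equiv.Perm ℕ) (k : ℕ) :
    p k < suffixMin p (k + 1) ↔ ∀ j, k < j → p k < p j := by
  refine ⟨fun h j hj => h.trans_le (suffixMin_le p hj), fun h => ?_⟩
  obtain ⟨i, hi, e⟩ := exists_eq_suffixMin p (k + 1)
  exact e ▸ h i hi

theorem exists_le_apply {p : ℕ → ℕ} {A : Finset ℕ} (hp : Set.InjOn p A) {k : ℕ}
    (h : k < A.card) : ∃ x ∈ A, k ≤ p x := by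
  by_contra! hn
  have := Finset.card_le_card_of_injOn (t := Finset.range k) p (by simpa [Set.MapsTo] using hn) hp
  rw [Finset.card_range] at this
  omega

/-- Every value below the minimum of the tail occurs before position `k`. -/
theorem suffixMin_le_card (p : Equiv.Perm ℕ) (k : ℕ) :
    suffixMin p k ≤ ((Finset.range k).filter fun x => p x < suffixMin p k).card := by
  have := Finset.card_le_card_of_injOn (s := Finset.range (suffixMin p k))
    (t := (Finset.range k).filter fun x => p x < suffixMin p k) p.symm (by
      intro y hy
      have hy : y < suffixMin p k := by simpa using hy
      have : p.symm y < k := by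
        by_contra hk
        have := suffixMin_le p (not_lt.mp hk)
        rw [Equiv.apply_symm_apply] at this
        omega
      simp [hy, this]) p.symm.injective.injOn
  simpa using this

theorem suffixMin_le_self (p : Equiv.Perm ℕ) (k : ℕ) : suffixMin p k ≤ k := by
  refine (suffixMin_le_card p k).trans ((Finset.card_filter_le _ _).trans ?_)
  rw [Finset.card_range]

theorem suffixMin_natPerm_of_le {n : ℕ} (π : Equiv.Perm (Fin n)) {k : ℕ} (h : n ≤ k) :
    suffixMin (natPerm π) k = k := by
  obtain ⟨i, hi, e⟩ := exists_eq_suffixMin (natPerm π) k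
  have := natPerm_of_le π (h.trans hi)
  have := suffixMin_le_self (natPerm π) k
  omega

/-- The sequences that encode both kinds of permutations. -/
structure IsCode (n : ℕ) (s : ℕ → ℕ) : Prop where
  zero : s 0 = 0
  succ_le : ∀ k, s (k + 1) ≤ s k + 1
  eq_zero : ∀ k, n ≤ k → s k = 0

theorem IsCode.le_add {n : ℕ} {s : ℕ → ℕ} (hs : IsCode n s) {k l : ℕ} (h : k ≤ l) :
    s l ≤ s k + (l - k) := by
  induction l, h using Nat.le_induction with
  | base => omega
  | succ l h ih =>
    have := hs.succ_le l
    omega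

theorem IsCode.le_self {n : ℕ} {s : ℕ → ℕ} (hs : IsCode n s) (k : ℕ) : s k ≤ k := by
  have := hs.le_add k.zero_le
  have := hs.zero
  omega

/-- The code of a permutation that avoids `321`. -/
noncomputable def code321 (p : ℕ → ℕ) (k : ℕ) : ℕ :=
  k - suffixMin p k

theorem isCode_code321 {n : ℕ} (π : Equiv.Perm (Fin n)) : IsCode n (code321 (natPerm π)) where
  zero := Nat.zero_sub _
  succ_le k := by
    have := suffixMin_mono (natPerm π) k.le_succ
    unfold code321
    simp only [Nat.succ_eq_add_one] at this
    omega
  eq_zero k h := by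
    rw [code321, suffixMin_natPerm_of_le π h, Nat.sub_self]

/-! ### The code of a 321-avoiding permutation. -/

section Avoids321

variable {p : Equiv.Perm ℕ} (hp : ∀ i j k : ℕ, i < j → j < k → p k < p j → ¬ p j < p i)

include hp

theorem apply_eq_self_iff (i : ℕ) :
    p i = i ↔ code321 p i = 0 ∧ code321 p (i + 1) = 0 := by
  have h₁ := suffixMin_le_self p i
  have h₂ := suffixMin_le_self p (i + 1)
  have h₃ := suffixMin_eq_min p i
  have h₄ := apply_ne_suffixMin_succ p i
  unfold code321
  constructor
  · intro h
    -- Otherwise a smaller letter `p m` follows; pigeonhole on the positions below `i` together with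
    -- `m` yields a larger letter before `i`, hence a 321.
    have : suffixMin p i = i := by
      by_contra hlt
      obtain ⟨m, hm, e⟩ := exists_eq_suffixMin p i
      have hmi : m ≠ i := by
        rintro rfl
        omega
      obtain ⟨x, hx, hx'⟩ := exists_le_apply (A := insert m (Finset.range i)) (k := i)
        p.injective.injOn (by rw [Finset.card_insert_of_notMem (by simpa using hm)]; simp)
      rw [Finset.mem_insert, Finset.mem_range] at hx
      have hxm : x ≠ m := by
        rintro rfl
        omega
      have hxi : p x ≠ p i := p.injective.ne (by omega)
      exact hp x i m (by omega) (by omega) (by omega) (by omega)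
    omega
  · omega

/-- By pigeonhole a drop has a larger letter before it, hence no smaller one after it. So `p i` is
the suffix minimum at `i`, which then jumps, and this is the code failing to rise. -/
theorem apply_lt_self_iff (i : ℕ) :
    p i < i ↔ 1 ≤ code321 p i ∧ code321 p (i + 1) ≤ code321 p i := by
  have h₁ := suffixMin_le_self p i
  have h₂ := suffixMin_le_self p (i + 1)
  have h₃ := suffixMin_eq_min p i
  unfold code321
  constructor
  · intro h
    obtain ⟨x, hx, hx'⟩ := exists_le_apply (A := Finset.range (i + 1)) (k := i)
      p.injective.injOn (by simp)
    rw [Finset.mem_range] at hx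
    have hxi : x ≠ i := by
      rintro rfl
      omega
    have : p i < suffixMin p (i + 1) := by
      rw [lt_suffixMin_succ_iff]
      intro j hj
      have := hp x i j (by omega) hj
      have : p j ≠ p i := p.injective.ne (by omega)
      omega
    omega
  · omega

/-- Exactly `code321 p k` letters before `k` exceed the suffix minimum, and a descent among them
would complete a 321 with it. -/
theorem hasIncreasingBefore_iff_code321 (t : ℕ) :
    HasIncreasingBefore p t ↔ ∃ k, t < code321 p k := by
  constructor
  · rintro ⟨B, j, hB, -, ht⟩
    refine ⟨j, ?_⟩
    have h₁ := suffixMin_le_card p j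
    have h₂ : B.card ≤ ((Finset.range j).filter fun x => ¬ p x < suffixMin p j).card := by
      refine Finset.card_le_card fun x hx => ?_
      have := hB x hx
      have := suffixMin_le p (le_refl j)
      simp only [Finset.mem_filter, Finset.mem_range]
      omega
    have h₃ := Finset.card_filter_add_card_filter_not (s := Finset.range j)
      fun x => p x < suffixMin p j
    rw [Finset.card_range] at h₃
    unfold code321
    omega
  · rintro ⟨k, hk⟩
    obtain ⟨i, hi, e⟩ := exists_eq_suffixMin p k
    refine ⟨(Finset.range k).filter fun x => ¬ p x < p i, i, fun x hx => ?_, ?_, ?_⟩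
    · simp only [Finset.mem_filter, Finset.mem_range] at hx
      have : p x ≠ p i := p.injective.ne (by omega)
      omega
    · intro x hx y hy hxy
      simp only [Finset.coe_filter, Finset.mem_range, Set.mem_ofPred_eq] at hx hy
      have h₁ : p y ≠ p i := p.injective.ne (by omega)
      have h₂ : p x ≠ p y := p.injective.ne (by omega)
      have := hp x y i hxy (by omega) (by omega)
      omega
    · have h₂ : ((Finset.range k).filter fun x => p x < p i).card ≤ p i := by
        simpa using Finset.card_le_card_of_injOn (s := (Finset.range k).filter fun x => p x < p i)
          (t := Finset.range (p i)) p (by intro x; simp) p.injective.injOn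
      have h₃ := Finset.card_filter_add_card_filter_not (s := Finset.range k) fun x => p x < p i
      rw [Finset.card_range] at h₃
      unfold code321 at hk
      omega

theorem strictMonoOn_of_suffixMin_eq :
    StrictMonoOn p {k | ¬ suffixMin p k < suffixMin p (k + 1)} := by
  intro i hi j hj hij
  have h₁ := suffixMin_eq_min p j
  have h₂ := apply_ne_suffixMin_succ p j
  obtain ⟨y, hy, e⟩ := exists_eq_suffixMin p (j + 1)
  have := hp i j y hij (by omega)
  have h₃ : p i ≠ p j := p.injective.ne (by omega)
  simp only [Set.mem_ofPred_eq] at hj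
  omega

end Avoids321

theorem apply_eq_suffixMin {p : ℕ → ℕ} {k : ℕ} (h : suffixMin p k < suffixMin p (k + 1)) :
    p k = suffixMin p k := by
  have := suffixMin_eq_min p k
  omega

/-- The code gives the suffix minima. They are the letters where they jump; elsewhere `p` is
increasing with known positions and known set of values. -/
theorem code321_injective {p q : Equiv.Perm ℕ}
    (hp : ∀ i j k : ℕ, i < j → j < k → p k < p j → ¬ p j < p i)
    (hq : ∀ i j k : ℕ, i < j → j < k → q k < q j → ¬ q j < q i)
    (h : code321 p = code321 q) : p = q := by
  have hM : suffixMin p = suffixMin q := by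
    funext k
    have := congrFun h k
    have := suffixMin_le_self p k
    have := suffixMin_le_self q k
    unfold code321 at *
    omega
  set R : Set ℕ := {k | suffixMin p k < suffixMin p (k + 1)} with hR
  have eR : Set.EqOn p q R := by
    intro k hk
    rw [apply_eq_suffixMin hk, apply_eq_suffixMin (p := q) (by rw [← hM]; exact hk), hM]
  have mp : StrictMono (fun x : (Rᶜ : Set ℕ) => p x) := fun x y hxy =>
    strictMonoOn_of_suffixMin_eq hp x.2 y.2 hxy
  have mq : StrictMono (fun x : (Rᶜ : Set ℕ) => q x) := fun x y hxy =>
    strictMonoOn_of_suffixMin_eq hq (by rw [← hM]; exact x.2) (by rw [← hM]; exact y.2) hxy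
  have key := (mp.range_inj mq).mp (by
    rw [← Function.comp_def p, ← Function.comp_def q, Set.range_comp, Set.range_comp,
      Subtype.range_coe, Set.image_compl_eq p.bijective, Set.image_compl_eq q.bijective,
      eR.image_eq])
  ext k
  by_cases hk : k ∈ R
  · exact eR hk
  · exact congrFun key ⟨k, hk⟩

theorem exists_natPerm_eq {n : ℕ} {f : ℕ → ℕ} (hf : ∀ k < n, f k < n)
    (hi : Set.InjOn f (Set.Iio n)) : ∃ π : Equiv.Perm (Fin n), ∀ k < n, natPerm π k = f k := by
  let g : Fin n → Fin n := fun i => ⟨f i, hf i i.isLt⟩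
  have hg : Function.Injective g := fun i j h =>
    Fin.ext (hi i.isLt j.isLt (congrArg Fin.val h))
  refine ⟨Equiv.ofBijective g (Finite.injective_iff_bijective.mp hg), fun k hk => ?_⟩
  exact natPerm_apply _ ⟨k, hk⟩

theorem exists_strictMonoOn_of_card_eq {A B : Finset ℕ} (h : A.card = B.card) :
    ∃ e : ℕ → ℕ, StrictMonoOn e A ∧ ∀ k ∈ A, e k ∈ B := by
  refine ⟨fun k => if hk : k ∈ A then
    B.orderIsoOfFin h.symm ((A.orderIsoOfFin rfl).symm ⟨k, hk⟩) else 0, ?_, ?_⟩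
  · intro i hi j hj hij
    simp only [Finset.mem_coe] at hi hj
    simp only [hi, hj, dif_pos]
    rw [Subtype.coe_lt_coe, OrderIso.lt_iff_lt, OrderIso.lt_iff_lt]
    exact hij
  · intro k hk
    simp only [hk, dif_pos]
    exact Subtype.coe_prop _

/-- `M` is the intended suffix minimum. Positions where it jumps receive `M k`; the others (`C`)
receive the unused letters in increasing order. A union of two increasing sequences avoids 321. -/
theorem exists_code321_eq {n : ℕ} {s : ℕ → ℕ} (hs : IsCode n s) :
    ∃ π : Equiv.Perm (Fin n), Avoids π pattern321 ∧ code321 (natPerm π) = s := by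
  let M : ℕ → ℕ := fun k => k - s k
  have hsk := hs.le_self
  have hMk : ∀ k, M k + s k = k := fun k => Nat.sub_add_cancel (hsk k)
  have hmono : Monotone M := monotone_nat_of_le_succ fun k => by
    have := hs.succ_le k
    have := hMk k
    have := hMk (k + 1)
    omega
  have hMn : ∀ k, n ≤ k → M k = k := fun k hk => by
    have := hMk k
    have := hs.eq_zero k hk
    omega
  let R : Finset ℕ := (Finset.range n).filter fun k => M k < M (k + 1)
  let C : Finset ℕ := (Finset.range n).filter fun k => ¬ M k < M (k + 1)
  have hCR : ∀ k, k ∉ C → M k < M (k + 1) := by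
    intro k hk
    by_cases hkn : k < n
    · by_contra hc
      exact hk (Finset.mem_filter.mpr ⟨Finset.mem_range.mpr hkn, hc⟩)
    · rw [hMn k (by omega), hMn (k + 1) (by omega)]
      omega
  have hstrict : ∀ i j, i < j → i ∉ C → M i < M j := fun i j hij hi =>
    (hCR i hi).trans_le (hmono hij)
  have hRC : ∀ k ∈ R, k ∉ C := fun k hk => by
    simp only [R, C, Finset.mem_filter] at *
    omega
  have hinj : Set.InjOn M (R : Set ℕ) := by
    intro i hi j hj hij
    rcases lt_trichotomy i j with h | h | h
    · have := hstrict i j h (hRC i hi)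
      omega
    · exact h
    · have := hstrict j i h (hRC j hj)
      omega
  have hsub : R.image M ⊆ Finset.range n := by
    intro y hy
    obtain ⟨k, hk, rfl⟩ := Finset.mem_image.mp hy
    have hkn : k < n := by
      simp only [R, Finset.mem_filter, Finset.mem_range] at hk
      exact hk.1
    have := hstrict k n hkn (hRC k hk)
    rw [hMn n le_rfl] at this
    exact Finset.mem_range.mpr this
  have hcard : C.card = (Finset.range n \ R.image M).card := by
    rw [Finset.card_sdiff_of_subset hsub, Finset.card_image_of_injOn hinj]
    have := Finset.card_filter_add_card_filter_not (s := Finset.range n)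
      fun k => M k < M (k + 1)
    simp only [R, C]
    omega
  obtain ⟨e, he, heV⟩ := exists_strictMonoOn_of_card_eq hcard
  let f : ℕ → ℕ := fun k => if k ∈ C then e k else M k
  have hfC : ∀ k, k ∈ C → f k = e k := fun k hk => if_pos hk
  have hfM : ∀ k, k ∉ C → f k = M k := fun k hk => if_neg hk
  have hR : ∀ k, k < n → k ∉ C → k ∈ R := by
    intro k hk hkC
    simp [R, hk, hCR k hkC]
  have hne : ∀ i j, i ∈ C → j < n → j ∉ C → f i ≠ f j := by
    intro i j hi hj hjC h
    rw [hfC i hi, hfM j hjC] at h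
    have := heV i hi
    rw [h, Finset.mem_sdiff] at this
    exact this.2 (Finset.mem_image_of_mem M (hR j hj hjC))
  have hfn : ∀ k < n, f k < n := by
    intro k hk
    by_cases hkC : k ∈ C
    · rw [hfC k hkC]
      exact Finset.mem_range.mp (Finset.mem_sdiff.mp (heV k hkC)).1
    · rw [hfM k hkC]
      exact Finset.mem_range.mp (hsub (Finset.mem_image_of_mem M (hR k hk hkC)))
  have hfi : Set.InjOn f (Set.Iio n) := by
    intro i hi j hj hij
    by_cases hiC : i ∈ C <;> by_cases hjC : j ∈ C
    · rw [hfC i hiC, hfC j hjC] at hij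
      exact he.injOn hiC hjC hij
    · exact absurd hij (hne i j hiC hj hjC)
    · exact absurd hij.symm (hne j i hjC hi hiC)
    · rw [hfM i hiC, hfM j hjC] at hij
      exact hinj (hR i hi hiC) (hR j hj hjC) hij
  obtain ⟨π, hπ⟩ := exists_natPerm_eq hfn hfi
  have hπ : ∀ k, natPerm π k = f k := by
    intro k
    by_cases hk : k < n
    · exact hπ k hk
    · have hkC : k ∉ C := by simp [C, hk]
      rw [natPerm_of_le π (by omega), hfM k hkC, hMn k (by omega)]
  -- Otherwise, by pigeonhole, one of the first `k + 1` letters is at least `M k`; this is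
  -- impossible on `C`, where `e` increases, and off `C`, where `M` jumps.
  have hlow : ∀ k, M k ≤ f k := by
    intro k
    by_cases hkC : k ∈ C
    · by_contra hlt
      obtain ⟨x, hx, hx'⟩ := exists_le_apply (p := natPerm π) (A := Finset.range (k + 1))
        (k := M k) (natPerm π).injective.injOn (by rw [Finset.card_range]; have := hMk k; omega)
      rw [Finset.mem_range] at hx
      rw [hπ] at hx'
      by_cases hxC : x ∈ C
      · have : e x ≤ e k := he.monotoneOn hxC hkC (by omega)
        rw [← hfC x hxC, ← hfC k hkC] at this
        omega
      · have hxk : x ≠ k := by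
          rintro rfl
          exact hxC hkC
        have := hstrict x k (by omega) hxC
        rw [← hfM x hxC] at this
        omega
    · exact (hfM k hkC).ge
  have hmonoC : ∀ i j, i < j → i ∈ C → j ∈ C → f i < f j := by
    intro i j hij hi hj
    rw [hfC i hi, hfC j hj]
    exact he hi hj hij
  have hmonoR : ∀ i j, i < j → i ∉ C → j ∉ C → f i < f j := by
    intro i j hij hi hj
    rw [hfM i hi, hfM j hj]
    exact hstrict i j hij hi
  refine ⟨π, ?_, ?_⟩
  · rw [avoids_pattern321_iff]
    intro i j k hij hjk
    rw [hπ, hπ, hπ]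
    have h₁ := hmonoC i j hij
    have h₂ := hmonoR i j hij
    have h₃ := hmonoC j k hjk
    have h₄ := hmonoR j k hjk
    have h₅ := hmonoC i k (hij.trans hjk)
    have h₆ := hmonoR i k (hij.trans hjk)
    by_cases hi : i ∈ C <;> by_cases hj : j ∈ C <;> by_cases hk : k ∈ C <;>
      simp only [hi, hj, hk, true_implies, false_implies, not_true_eq_false,
        not_false_eq_true] at h₁ h₂ h₃ h₄ h₅ h₆ <;> omega
  · funext k
    have hm : suffixMin (natPerm π) k = M k := by
      apply le_antisymm
      -- `M` is eventually the identity, so it jumps at some position from `k` on; at the first jump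
      -- the letter is `M k`.
      · have : ∃ i, k ≤ i ∧ M i = M k ∧ M i < M (i + 1) := by
          by_contra! hn
          have hc : ∀ i, k ≤ i → M i = M k := by
            intro i hi
            induction i, hi using Nat.le_induction with
            | base => rfl
            | succ i hi ih =>
              have := hn i hi ih
              have := hmono i.le_succ
              simp only [Nat.succ_eq_add_one] at this
              omega
          have h₁ := hc (max n k + 1) (by omega)
          rw [hMn _ (by omega)] at h₁
          have := hMk k
          omega
        obtain ⟨i, hi, e₁, e₂⟩ := this
        have hiC : i ∉ C := by simp [C, e₂]
        rw [← e₁, ← hfM i hiC, ← hπ]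
        exact suffixMin_le _ hi
      · obtain ⟨i, hi, e⟩ := exists_eq_suffixMin (natPerm π) k
        rw [← e, hπ]
        exact (hmono hi).trans (hlow i)
    have := hMk k
    unfold code321
    omega

/-! ### The code of a 213-avoiding permutation. -/

/-- The positions counted by the code of a permutation that avoids `213`. -/
noncomputable def codeSet213 (p : ℕ → ℕ) (k : ℕ) : Finset ℕ :=
  -- At `k = 0` the range is empty, so the truncated `k - 1` is harmless.
  (Finset.range k).filter fun j => suffixMin p k < p j ∧ p j ≤ p (k - 1)

/-- The code of a permutation that avoids `213`. -/
noncomputable def code213 (p : ℕ → ℕ) (k : ℕ) : ℕ :=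
  (codeSet213 p k).card

theorem mem_codeSet213_succ {p : ℕ → ℕ} {j k : ℕ} :
    j ∈ codeSet213 p (k + 1) ↔ j ≤ k ∧ suffixMin p (k + 1) < p j ∧ p j ≤ p k := by
  simp [codeSet213]

theorem code213_zero (p : ℕ → ℕ) : code213 p 0 = 0 := by
  simp [code213, codeSet213]

theorem code213_succ_eq_zero_iff (p : Equiv.Perm ℕ) (k : ℕ) :
    code213 p (k + 1) = 0 ↔ p k < suffixMin p (k + 1) := by
  have h := apply_ne_suffixMin_succ p k
  rw [code213, Finset.card_eq_zero, Finset.eq_empty_iff_forall_notMem]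
  simp only [mem_codeSet213_succ]
  constructor
  · intro hn
    have := hn k
    omega
  · intro hlt j hj
    omega

theorem mem_codeSet213_self {p : Equiv.Perm ℕ} {k : ℕ} (h : code213 p (k + 1) ≠ 0) :
    k ∈ codeSet213 p (k + 1) := by
  rw [Ne, code213_succ_eq_zero_iff] at h
  have := apply_ne_suffixMin_succ p k
  rw [mem_codeSet213_succ]
  omega

theorem code213_of_le {n : ℕ} (π : Equiv.Perm (Fin n)) {k : ℕ} (h : n ≤ k) :
    code213 (natPerm π) k = 0 := by
  rcases k with _ | k
  · exact code213_zero _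
  · rw [code213_succ_eq_zero_iff, suffixMin_natPerm_of_le π h]
    by_cases hk : k < n
    · have := natPerm_lt π hk
      omega
    · rw [natPerm_of_le π (by omega)]
      omega

/-- Here `l` is the first later position with a letter below `p i`. The letters in between are too
large to count, so going from `i` to `l` at most trades `i` for `l`. -/
theorem code213_le_of_lt {p : Equiv.Perm ℕ} {i l : ℕ} (hil : i < l) (h : p l < p i)
    (hmin : ∀ x, i < x → x < l → p i < p x) : code213 p (l + 1) ≤ code213 p (i + 1) := by
  have hM := suffixMin_mono p (by omega : i + 1 ≤ l + 1)
  have hi : i ∈ codeSet213 p (i + 1) := by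
    have := suffixMin_le p (by omega : i + 1 ≤ l)
    rw [mem_codeSet213_succ]
    omega
  have hsub : codeSet213 p (l + 1) ⊆ insert l ((codeSet213 p (i + 1)).erase i) := by
    intro x hx
    rw [mem_codeSet213_succ] at hx
    rw [Finset.mem_insert, Finset.mem_erase, mem_codeSet213_succ]
    by_cases hxl : x = l
    · exact Or.inl hxl
    · have := hmin x
      have hxi : x ≠ i := by
        rintro rfl
        omega
      omega
  have h₁ := Finset.card_le_card hsub
  have h₂ := Finset.card_insert_le l ((codeSet213 p (i + 1)).erase i)
  rw [Finset.card_erase_of_mem hi] at h₂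
  have h₃ := Finset.card_pos.mpr ⟨i, hi⟩
  unfold code213
  omega

section Avoids213

variable {n : ℕ} {π : Equiv.Perm (Fin n)}
  (h : ∀ i j k : ℕ, i < j → j < k → k < n → natPerm π j < natPerm π i →
    ¬ natPerm π i < natPerm π k)

include h

/-- Avoiding 213 makes all letters after `i` up to `j` exceed `p i`, so the suffix minimum lies
beyond `j`. All that counts at `i + 1` still counts at `l + 1`, and `l` is new. -/
theorem code213_lt_of_lt {i j l : ℕ} (hil : i < l) (hlj : l ≤ j) (hj : j < n)
    (hij : natPerm π i < natPerm π j) (h₀ : code213 (natPerm π) (i + 1) ≠ 0) :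
    code213 (natPerm π) (i + 1) < code213 (natPerm π) (l + 1) := by
  have hi := mem_codeSet213_self h₀
  rw [mem_codeSet213_succ] at hi
  have hbig : ∀ x, i < x → x ≤ j → natPerm π i < natPerm π x := by
    intro x hix hxj
    rcases hxj.eq_or_lt with rfl | hxj
    · exact hij
    · by_contra hx
      have hne : natPerm π i ≠ natPerm π x := (natPerm π).injective.ne (by omega)
      exact h i x j hix hxj hj (by omega) hij
  have hl := hbig l hil hlj
  obtain ⟨y, hy, e⟩ := exists_eq_suffixMin (natPerm π) (i + 1)
  have hyj : j < y := by
    by_contra hyj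
    have := hbig y (by omega) (by omega)
    omega
  have hM := suffixMin_le (natPerm π) (by omega : l + 1 ≤ y)
  refine Finset.card_lt_card ((Finset.ssubset_iff_of_subset fun x hx => ?_).mpr ⟨l, ?_, ?_⟩)
  · rw [mem_codeSet213_succ] at hx ⊢
    omega
  · rw [mem_codeSet213_succ]
    omega
  · rw [mem_codeSet213_succ]
    omega

theorem code213_succ_le (k : ℕ) :
    code213 (natPerm π) (k + 1) ≤ code213 (natPerm π) k + 1 := by
  rcases k with _ | k
  · rw [code213_zero]
    exact (Finset.card_filter_le _ _).trans (by simp)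
  by_cases hk : n ≤ k + 1
  · rw [code213_of_le π (by omega : n ≤ k + 1 + 1)]
    omega
  suffices hsub : codeSet213 (natPerm π) (k + 1 + 1) ⊆
      insert (k + 1) (codeSet213 (natPerm π) (k + 1)) from
    (Finset.card_le_card hsub).trans (Finset.card_insert_le _ _)
  intro x hx
  rw [Finset.mem_insert]
  rw [mem_codeSet213_succ] at hx ⊢
  by_cases hxk : x = k + 1
  · exact Or.inl hxk
  have hM := suffixMin_mono (natPerm π) (k + 1).le_succ
  simp only [Nat.succ_eq_add_one] at hM
  have hx' : natPerm π x ≠ natPerm π (k + 1) := (natPerm π).injective.ne (by omega)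
  by_cases hxk' : x = k
  · subst hxk'
    omega
  -- If `p k < p x`, positions `x`, `k`, `k + 1` would form a 213.
  · have := h x k (k + 1) (by omega) (by omega) (by omega)
    omega

theorem isCode_code213 : IsCode n (code213 (natPerm π)) where
  zero := code213_zero _
  succ_le := code213_succ_le h
  eq_zero _ hk := code213_of_le π hk

omit h in
-- A smaller letter immediately before a right-to-left minimum is itself one.
theorem bad_iff (i : ℕ) :
    ((∀ j, i < j → natPerm π i < natPerm π j) ∧
      (i = 0 ∨ ∃ j, j + 1 = i ∧ natPerm π j < natPerm π i)) ↔
    code213 (natPerm π) i = 0 ∧ code213 (natPerm π) (i + 1) = 0 := by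
  rw [← lt_suffixMin_succ_iff, code213_succ_eq_zero_iff]
  have hmin := suffixMin_eq_min (natPerm π) i
  rcases i with _ | i
  · simp [code213_zero]
  · rw [code213_succ_eq_zero_iff]
    constructor
    · rintro ⟨h₁, h₂ | ⟨j, h₂, h₃⟩⟩
      · omega
      · obtain rfl : j = i := by omega
        omega
    · rintro ⟨h₁, h₂⟩
      exact ⟨h₂, Or.inr ⟨i, rfl, by omega⟩⟩

theorem descent_iff (i : ℕ) :
    natPerm π (i + 1) < natPerm π i ↔
      1 ≤ code213 (natPerm π) (i + 1) ∧
        code213 (natPerm π) (i + 1 + 1) ≤ code213 (natPerm π) (i + 1) := by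
  have hz := code213_succ_eq_zero_iff (natPerm π) i
  constructor
  · intro hlt
    have := suffixMin_le (natPerm π) (le_refl (i + 1))
    exact ⟨by omega, code213_le_of_lt i.lt_succ_self hlt (by omega)⟩
  · rintro ⟨h₁, h₂⟩
    by_contra hn
    have hne : natPerm π i ≠ natPerm π (i + 1) := (natPerm π).injective.ne (by omega)
    have hin : i + 1 < n := by
      by_contra hi
      have := code213_of_le π (not_lt.mp hi)
      omega
    have := code213_lt_of_lt h (by omega : i < i + 1) le_rfl hin (by omega) (by omega)
    omega

theorem hasIncreasingBefore_iff_code213 (t : ℕ) :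
    HasIncreasingBefore (natPerm π) t ↔ ∃ k, t < code213 (natPerm π) k := by
  constructor
  · rintro ⟨B, j, hB, hm, ht⟩
    have hne : B.Nonempty := Finset.card_pos.mp (by omega)
    have hmax := B.max'_mem hne
    -- The last letter of the increasing sequence is its largest, so cutting just after it counts
    -- all of `B`.
    refine ⟨B.max' hne + 1, ht.trans_le (Finset.card_le_card fun x hx => ?_)⟩
    have h₁ := B.le_max' x hx
    have h₂ := hm.monotoneOn hx hmax h₁
    have h₃ := suffixMin_le (natPerm π) (hB _ hmax).1
    have h₄ := hB x hx
    simp only [Nat.succ_eq_add_one] at h₃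
    rw [mem_codeSet213_succ]
    omega
  · rintro ⟨k, hk⟩
    rcases k with _ | k
    · rw [code213_zero] at hk
      omega
    have hkn : k + 1 < n := by
      by_contra hi
      have := code213_of_le π (not_lt.mp hi)
      omega
    obtain ⟨i, hi, e⟩ := exists_eq_suffixMin (natPerm π) (k + 1)
    refine ⟨codeSet213 (natPerm π) (k + 1), i, fun x hx => ?_, fun x hx y hy hxy => ?_, hk⟩
    · rw [mem_codeSet213_succ] at hx
      omega
    · rw [Finset.mem_coe, mem_codeSet213_succ] at hx hy
      have h₁ : natPerm π x ≠ natPerm π y := (natPerm π).injective.ne (by omega)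
      have h₂ : natPerm π x ≠ natPerm π k := (natPerm π).injective.ne (by omega)
      rcases hy.1.eq_or_lt with rfl | hyk
      · omega
      · have := h x y k hxy hyk (by omega)
        omega

/-- The code thus decides every comparison, whence injectivity. If `p j < p i`, the first later
letter below `p i` refutes the right side by `code213_le_of_lt`. -/
theorem natPerm_lt_iff_code213 {i j : ℕ} (hij : i < j) (hj : j < n) :
    natPerm π i < natPerm π j ↔ code213 (natPerm π) (i + 1) = 0 ∨
      ∀ l, i < l → l ≤ j → code213 (natPerm π) (i + 1) < code213 (natPerm π) (l + 1) := by
  constructor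
  · intro hlt
    by_cases h₀ : code213 (natPerm π) (i + 1) = 0
    · exact Or.inl h₀
    · exact Or.inr fun l hil hlj => code213_lt_of_lt h hil hlj hj hlt h₀
  · intro hr
    by_contra hn
    have hne : natPerm π i ≠ natPerm π j := (natPerm π).injective.ne (by omega)
    have hex : ∃ l, i < l ∧ natPerm π l < natPerm π i := ⟨j, hij, by omega⟩
    classical
    obtain ⟨h₁, h₂⟩ := Nat.find_spec hex
    have h₃ := code213_le_of_lt h₁ h₂ (by
      intro x hix hx
      have := Nat.find_min hex hx
      have hne : natPerm π i ≠ natPerm π x := (natPerm π).injective.ne (by omega)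
      omega)
    have h₄ : Nat.find hex ≤ j := Nat.find_min' hex ⟨hij, by omega⟩
    rcases hr with hr | hr
    · rw [code213_succ_eq_zero_iff, lt_suffixMin_succ_iff] at hr
      have := hr _ h₁
      omega
    · have := hr _ h₁ h₄
      omega

end Avoids213

theorem code213_injective {n : ℕ} {π σ : Equiv.Perm (Fin n)} (hπ : Avoids π pattern213)
    (hσ : Avoids σ pattern213) (h : code213 (natPerm π) = code213 (natPerm σ)) : π = σ := by
  rw [avoids_pattern213_iff] at hπ hσ
  have key : ∀ i j : Fin n, i < j → (π i < π j ↔ σ i < σ j) := by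
    intro i j hij
    rw [Fin.lt_def, Fin.lt_def, ← natPerm_apply, ← natPerm_apply, ← natPerm_apply,
      ← natPerm_apply, natPerm_lt_iff_code213 hπ hij j.isLt, natPerm_lt_iff_code213 hσ hij j.isLt,
      h]
  have key : ∀ i j : Fin n, π i ≤ π j ↔ σ i ≤ σ j := by
    intro i j
    rcases lt_trichotomy i j with hij | rfl | hij
    · rw [(π.injective.ne hij.ne).le_iff_lt, (σ.injective.ne hij.ne).le_iff_lt, key i j hij]
    · simp
    · rw [← not_lt, ← not_lt, key j i hij]
  let e : Fin n ≃o Fin n := ⟨σ.symm.trans π, by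
    intro a b
    simpa using key (σ.symm a) (σ.symm b)⟩
  have he : e = OrderIso.refl _ := Subsingleton.elim _ _
  ext i
  have := congrArg (fun f : Fin n ≃o Fin n => f (σ i)) he
  simpa [e] using congrArg Fin.val this

/-! ### Counting codes by 213-avoiding permutations. -/

theorem exists_natPerm_of_isCode {n : ℕ} {s : ℕ → ℕ} (hs : IsCode n s) :
    ∃ (π : Equiv.Perm (Fin n)) (e : ℕ → ℕ),
      Avoids π pattern213 ∧ (∀ k < n, natPerm π k + e k = s k + n) ∧
        (∀ k < n, k < e k ∧ e k ≤ n) ∧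
        (∀ i j, i < j → j < n → (natPerm π i < natPerm π j ↔ j < e i)) := by
  classical
  have hex : ∀ k, ∃ l, k < l ∧ (n ≤ l ∨ s l ≤ s k) := fun k => ⟨n + k + 1, by omega, by omega⟩
  -- For `k < n`, this is the next position where `s` returns to `s k` or below, capped at `n`. The
  -- letter `f k` exceeds `s k` letters before it and the `n - e k` letters from `e k` on.
  let e : ℕ → ℕ := fun k => Nat.find (hex k)
  have he₁ : ∀ k, k < e k ∧ (n ≤ e k ∨ s (e k) ≤ s k) := fun k => Nat.find_spec (hex k)
  have he₂ : ∀ k l, k < l → (n ≤ l ∨ s l ≤ s k) → e k ≤ l := fun k l h₁ h₂ =>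
    Nat.find_min' (hex k) ⟨h₁, h₂⟩
  have hen : ∀ k < n, e k ≤ n := fun k hk => he₂ k n hk (Or.inl le_rfl)
  let f : ℕ → ℕ := fun k => s k + n - e k
  have hf : ∀ k < n, f k + e k = s k + n := fun k hk =>
    Nat.sub_add_cancel (by have := hen k hk; omega)
  have hlt : ∀ i j, i < j → j < n → j < e i → f i < f j := by
    intro i j hij hj hje
    have h₁ : ¬ s j ≤ s i := fun hle => by
      have := he₂ i j hij (Or.inr hle)
      omega
    have h₂ := he₁ i
    have h₃ : e j ≤ e i := he₂ j (e i) hje (by omega)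
    have := hf i (by omega)
    have := hf j hj
    omega
  have hgt : ∀ i j, i < j → j < n → e i ≤ j → f j < f i := by
    intro i j hij hj hje
    have h₁ := he₁ i
    have h₂ := he₁ j
    have h₃ := hs.le_add hje
    have := hf i (by omega)
    have := hf j hj
    omega
  have hinj : Set.InjOn f (Set.Iio n) := by
    intro i hi j hj hij
    simp only [Set.mem_Iio] at hi hj
    by_contra hne
    rcases Nat.lt_or_gt_of_ne hne with hlt' | hlt'
    · have := hlt i j hlt' hj
      have := hgt i j hlt' hj
      omega
    · have := hlt j i hlt' hi
      have := hgt j i hlt' hi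
      omega
  have hfn : ∀ k < n, f k < n := by
    intro k hk
    have := hf k hk
    have := he₁ k
    have := hs.le_self k
    omega
  obtain ⟨π, hπ⟩ := exists_natPerm_eq hfn hinj
  have hiff : ∀ i j, i < j → j < n → (natPerm π i < natPerm π j ↔ j < e i) := by
    intro i j hij hj
    rw [hπ i (by omega), hπ j hj]
    have := hlt i j hij hj
    have := hgt i j hij hj
    omega
  refine ⟨π, e, ?_, fun k hk => by rw [hπ k hk, hf k hk], fun k hk => ⟨(he₁ k).1, hen k hk⟩, hiff⟩
  rw [avoids_pattern213_iff]
  intro i j k hij hjk hk h₁ h₂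
  have h₃ := hiff i j hij (by omega)
  have h₄ := hiff i k (by omega) hk
  omega

/-- A map from codes to permutations that avoid `213`. -/
noncomputable def permOfCode {n : ℕ} (s : {s // IsCode n s}) :
    {π : Equiv.Perm (Fin n) // Avoids π pattern213} :=
  ⟨(exists_natPerm_of_isCode s.2).choose,
    (exists_natPerm_of_isCode s.2).choose_spec.choose_spec.1⟩

/-- The permutation determines `e k` as the next position with a smaller letter, or `n`; the letter
at `k` then gives `s k`. -/
theorem permOfCode_injective (n : ℕ) : Function.Injective (permOfCode (n := n)) := by
  intro s s' h
  have h : (exists_natPerm_of_isCode s.2).choose = (exists_natPerm_of_isCode s'.2).choose :=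
    congrArg Subtype.val h
  obtain ⟨e, -, h₁, h₂, h₃⟩ := (exists_natPerm_of_isCode s.2).choose_spec
  obtain ⟨e', -, h₁', h₂', h₃'⟩ := (exists_natPerm_of_isCode s'.2).choose_spec
  rw [← h] at h₁' h₃'
  have he : ∀ k < n, e k = e' k := by
    intro k hk
    have a₁ := h₂ k hk
    have a₂ := h₂' k hk
    by_contra hne
    rcases Nat.lt_or_gt_of_ne hne with hlt | hlt
    · have := h₃ k (e k) a₁.1 (by omega)
      have := h₃' k (e k) a₁.1 (by omega)
      omega
    · have := h₃ k (e' k) a₂.1 (by omega)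
      have := h₃' k (e' k) a₂.1 (by omega)
      omega
  ext k
  by_cases hk : k < n
  · have := h₁ k hk
    have := h₁' k hk
    have := he k hk
    omega
  · rw [s.2.eq_zero k (by omega), s'.2.eq_zero k (by omega)]

/-- Permutations that avoid `321` correspond to their codes. -/
noncomputable def codeEquiv321 (n : ℕ) :
    {π : Equiv.Perm (Fin n) // Avoids π pattern321} ≃ {s // IsCode n s} :=
  Equiv.ofBijective (fun π => ⟨code321 (natPerm π.1), isCode_code321 π.1⟩) <| by
    constructor
    · intro π σ h
      exact Subtype.ext (natPerm_injective (code321_injective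
        ((avoids_pattern321_iff _).mp π.2) ((avoids_pattern321_iff _).mp σ.2)
        (congrArg Subtype.val h)))
    · intro s
      obtain ⟨π, hπ, e⟩ := exists_code321_eq s.2
      exact ⟨⟨π, hπ⟩, Subtype.ext e⟩

/-- Permutations that avoid `213` correspond to their codes. -/
noncomputable def codeEquiv213 (n : ℕ) :
    {π : Equiv.Perm (Fin n) // Avoids π pattern213} ≃ {s // IsCode n s} :=
  Equiv.ofBijective (fun π => ⟨code213 (natPerm π.1),
    isCode_code213 ((avoids_pattern213_iff _).mp π.2)⟩) <| by
    -- Codes are finite in number through the 321 class, and `permOfCode` is used only to bound that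
    -- number; it need not invert the code.
    have : Finite {s // IsCode n s} := Finite.of_equiv _ (codeEquiv321 n)
    refine Function.Injective.bijective_of_nat_card_le (fun π σ h => ?_)
      (Nat.card_le_card_of_injective _ (permOfCode_injective n))
    exact Subtype.ext (code213_injective π.2 σ.2 (congrArg Subtype.val h))

/-! ### The bijection and its statistics. -/

/-- The bijection from permutations that avoid `321` to permutations that avoid `213`. -/
noncomputable def avoidsEquiv (n : ℕ) :
    {π : Equiv.Perm (Fin n) // Avoids π pattern321} ≃
      {π : Equiv.Perm (Fin n) // Avoids π pattern213} :=
  (codeEquiv321 n).trans (codeEquiv213 n).symm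

section avoidsEquiv

variable {n : ℕ} (π : {π : Equiv.Perm (Fin n) // Avoids π pattern321})

theorem code213_avoidsEquiv :
    code213 (natPerm (avoidsEquiv n π).1) = code321 (natPerm π.1) :=
  congrArg Subtype.val ((codeEquiv213 n).apply_symm_apply (codeEquiv321 n π))

theorem isStackSortable_avoidsEquiv (t : ℕ) :
    IsStackSortable t (avoidsEquiv n π).1 ↔ IsStackSortable t π.1 := by
  rw [isStackSortable_iff_of_avoids _ (Or.inl π.2),
    isStackSortable_iff_of_avoids _ (Or.inr (avoidsEquiv n π).2),
    hasIncreasingBefore_iff_code321 ((avoids_pattern321_iff _).mp π.2),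
    hasIncreasingBefore_iff_code213 ((avoids_pattern213_iff _).mp (avoidsEquiv n π).2),
    code213_avoidsEquiv]

theorem fix_eq_bad_avoidsEquiv : fix π.1 = bad (avoidsEquiv n π).1 := by
  unfold fix bad
  congr 1
  ext i
  have h₁ := apply_eq_self_iff ((avoids_pattern321_iff _).mp π.2) i
  have h₂ := bad_iff (π := (avoidsEquiv n π).1) i
  rw [code213_avoidsEquiv, ← h₁] at h₂
  simp only [Finset.mem_filter, Finset.mem_univ, true_and, Fin.ext_iff]
  rw [← natPerm_apply, ← h₂]
  simp only [gt_iff_lt, Fin.lt_def, ← natPerm_apply]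
  refine and_congr ⟨fun h j hj => h j hj, fun h j hj => ?_⟩
    (or_congr Iff.rfl ⟨?_, fun ⟨j, hj, h⟩ => ⟨j, hj, h⟩⟩)
  · by_cases hjn : j < n
    · exact h ⟨j, hjn⟩ hj
    · have := natPerm_lt (avoidsEquiv n π).1 i.isLt
      rw [natPerm_of_le _ (not_lt.mp hjn)]
      omega
  · rintro ⟨j, hj, h⟩
    exact ⟨⟨j, by omega⟩, hj, h⟩

/-- Drops sit one position after the matching descents; the vanishing of the code at `0` and from
`n` on keeps the shift in range. -/
theorem drop_eq_des_avoidsEquiv : drop π.1 = des (avoidsEquiv n π).1 := by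
  have hs := isCode_code321 π.1
  have hdes : ∀ i : Fin n, (∃ j : Fin n, j.val = i.val + 1 ∧
      (avoidsEquiv n π).1 i > (avoidsEquiv n π).1 j) ↔
      1 ≤ code321 (natPerm π.1) (i + 1) ∧
        code321 (natPerm π.1) (i + 1 + 1) ≤ code321 (natPerm π.1) (i + 1) := by
    intro i
    rw [← code213_avoidsEquiv, ← descent_iff ((avoids_pattern213_iff _).mp (avoidsEquiv n π).2)]
    simp only [gt_iff_lt, Fin.lt_def, ← natPerm_apply]
    constructor
    · rintro ⟨j, hj, h⟩
      rwa [← hj]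
    · intro h
      exact ⟨⟨i + 1, lt_of_natPerm_inversion _ (Nat.lt_succ_self _) h⟩, rfl, h⟩
  have hdrop : ∀ i : Fin n, π.1 i < i ↔
      1 ≤ code321 (natPerm π.1) i ∧ code321 (natPerm π.1) (i + 1) ≤ code321 (natPerm π.1) i := by
    intro i
    rw [← apply_lt_self_iff ((avoids_pattern321_iff _).mp π.2), Fin.lt_def, natPerm_apply]
  unfold drop des
  simp only [hdes, hdrop]
  have h₀ := hs.zero
  have hn := hs.eq_zero n le_rfl
  symm
  refine Finset.card_bij' (fun i _ => if h : i.val + 1 < n then ⟨i + 1, h⟩ else i)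
    (fun i _ => ⟨i - 1, by omega⟩) ?_ ?_ ?_ ?_
  all_goals
    intro i hi
    simp only [Finset.mem_filter, Finset.mem_univ, true_and] at hi ⊢
  · have hin : i.val + 1 < n := by
      by_contra hin
      rw [hs.eq_zero _ (not_lt.mp hin)] at hi
      omega
    rw [dif_pos hin]
    exact hi
  · have hi₀ : i.val ≠ 0 := fun h => by
      rw [h] at hi
      omega
    rw [Nat.sub_add_cancel (by omega)]
    exact hi
  · have hin : i.val + 1 < n := by
      by_contra hin
      rw [hs.eq_zero _ (not_lt.mp hin)] at hi
      omega
    rw [Fin.ext_iff, dif_pos hin]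
    simp
  · have hi₀ : i.val ≠ 0 := fun h => by
      rw [h] at hi
      omega
    rw [Fin.ext_iff, dif_pos (by omega)]
    simp only
    omega

end avoidsEquiv

end StackSorting

theorem mainTheorem1 (n : ℕ) :
    (∃ Υ : {π : Equiv.Perm (Fin n) // StackSorting.Avoids π StackSorting.pattern321} ≃
        {σ : Equiv.Perm (Fin n) // StackSorting.Avoids σ StackSorting.pattern213},
      (∀ t : ℕ, 1 ≤ t → ∀ π,
        (StackSorting.IsStackSortable t (Υ π).val ↔ StackSorting.IsStackSortable t π.val)) ∧
      ∀ π, StackSorting.fix π.val = StackSorting.bad (Υ π).val ∧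
        StackSorting.drop π.val = StackSorting.des (Υ π).val) ∧
    (∀ t : ℕ, 1 ≤ t →
      (∑ π ∈ StackSorting.sortableAvoiding n t StackSorting.pattern321,
          (MvPolynomial.X 0 ^ StackSorting.fix π * MvPolynomial.X 1 ^ StackSorting.drop π :
            MvPolynomial (Fin 2) ℤ)) =
        ∑ σ ∈ StackSorting.sortableAvoiding n t StackSorting.pattern213,
          (MvPolynomial.X 0 ^ StackSorting.bad σ * MvPolynomial.X 1 ^ StackSorting.des σ :
            MvPolynomial (Fin 2) ℤ)) ∧
    (∀ t : ℕ, 1 ≤ t →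
      (StackSorting.sortableAvoiding n t StackSorting.pattern321).card =
        (StackSorting.sortableAvoiding n t StackSorting.pattern213).card) := by
  have hmem : ∀ {t k : ℕ} {p : Equiv.Perm (Fin k)} {π : Equiv.Perm (Fin n)},
      π ∈ StackSorting.sortableAvoiding n t p ↔
        StackSorting.IsStackSortable t π ∧ StackSorting.Avoids π p := by
    intro t k p π
    simp [StackSorting.sortableAvoiding]
  -- An arbitrary weight covers both the polynomial identity and, with weight 1, the cardinalities.
  have hsum : ∀ {M : Type} [AddCommMonoid M] (t : ℕ) (f g : Equiv.Perm (Fin n) → M),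
      (∀ π, f π.1 = g (StackSorting.avoidsEquiv n π).1) →
      ∑ π ∈ StackSorting.sortableAvoiding n t StackSorting.pattern321, f π =
        ∑ σ ∈ StackSorting.sortableAvoiding n t StackSorting.pattern213, g σ := by
    intro M _ t f g hfg
    refine Finset.sum_bij' (fun π hπ => (StackSorting.avoidsEquiv n ⟨π, (hmem.mp hπ).2⟩).1)
      (fun σ hσ => ((StackSorting.avoidsEquiv n).symm ⟨σ, (hmem.mp hσ).2⟩).1) ?_ ?_ ?_ ?_ ?_
    · intro π hπ
      exact hmem.mpr ⟨(StackSorting.isStackSortable_avoidsEquiv _ t).mpr (hmem.mp hπ).1,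
        (StackSorting.avoidsEquiv n ⟨π, (hmem.mp hπ).2⟩).2⟩
    · intro σ hσ
      refine hmem.mpr ⟨(StackSorting.isStackSortable_avoidsEquiv _ t).mp ?_,
        ((StackSorting.avoidsEquiv n).symm ⟨σ, (hmem.mp hσ).2⟩).2⟩
      rw [Equiv.apply_symm_apply]
      exact (hmem.mp hσ).1
    · intro π hπ
      simp
    · intro σ hσ
      simp
    · intro π hπ
      exact hfg ⟨π, _⟩
  refine ⟨⟨StackSorting.avoidsEquiv n, fun t _ π => StackSorting.isStackSortable_avoidsEquiv π t,
    fun π => ⟨StackSorting.fix_eq_bad_avoidsEquiv π, StackSorting.drop_eq_des_avoidsEquiv π⟩⟩,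
    fun t _ => hsum t _ _ fun π => ?_, fun t _ => ?_⟩
  · rw [StackSorting.fix_eq_bad_avoidsEquiv, StackSorting.drop_eq_des_avoidsEquiv]
  · rw [Finset.card_eq_sum_ones, Finset.card_eq_sum_ones]
    exact hsum t (fun _ => 1) (fun _ => 1) fun _ => rfl
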